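/- **Theorem (Online Median Estimation Lower Bound).** Consider the online comparison feedback model on $[n+1]=\{1,\dots,n+1\}$ with time horizon $T$. An oblivious adversary, knowing $T$, commits at the start to a (possibly random) sequence $x_1,\dots,x_T\in[n+1]$. A randomized fixed-horizon algorithm $\mathcal A$, knowing $n$ and $T$ and using random choices independent of the adversary's, chooses in each round $t=1,\dots,T$ a query $q_t\in[n]$ depending on its internal randomness and the feedback of the earlier rounds, then receives the bit $1(x_t\le q_t)$, and produces an estimate $\hat m_t\in[n+1]$. With $F_T(i)=\frac1T\sum_{t\le T}1(x_t\le i)$, its error at time $T$ is $$E(T)=\operatorname{dist}\bigl([F_T(\hat m_T-1),F_T(\hat m_T)],\tfrac12\bigr).$$ The fixed-horizon query complexity $T_0(n,\varepsilon)\in\mathbb N\cup\{\infty\}$ of $\mathcal A$ against oblivious adversaries is the least $T_0$ such that for all $T>T_0$ and all oblivious adversaries, $E(T)\le\varepsilon$ with probability at least $3/4$ ($\infty$ if there is no such $T_0$). Then no online median estimation algorithm has fixed-horizon query complexity $o(n/\varepsilon^2)$ against oblivious adversaries. Precisely: 1. There are $n_0\in\mathbb N$ and constants $a,c>0$ such that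 for all $n\ge n_0$ and all $0<\varepsilon\le a/n$, every fixed-horizon algorithm on $[n+1]$ has query complexity $T_0(n,\varepsilon)\ge c\,n/\varepsilon^2$ against oblivious adversaries. 2. In particular, for every algorithm (a family of fixed-horizon algorithms, one for each $n\ge1$), the ratio $T_0(n,\varepsilon)\big/(n/\varepsilon^2)$ does not tend to $0$ as $n\to\infty$ and $\varepsilon\to0^+$. -/

import Mathlib

open Filter Topology
open scoped ENNReal

namespace OnlineMedian

/-- The sample space `[n+1] = {1, …, n+1}`. -/
abbrev Sample (n : ℕ) : Type := {i : ℕ // i ∈ Finset.Icc 1 (n + 1)}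

/-- The query space `[n] = {1, …, n}`. -/
abbrev Query (n : ℕ) : Type := {i : ℕ // i ∈ Finset.Icc 1 n}

/-- The empirical CDF `F_T(i) = (1/T) ∑_{t} 1(x_t ≤ i)` of the samples `x_1, …, x_T`. -/
noncomputable def empCDF {n T : ℕ} (x : Fin T → Sample n) (i : ℕ) : ℝ :=
  (∑ t, if (x t : ℕ) ≤ i then (1 : ℝ) else 0) / T

/-- The median estimation error `dist([F_T(m-1), F_T(m)], 1/2)` of the estimate `m`
for the samples `x_1, …, x_T` (here `m ≥ 1`, so that `m - 1` is a true difference). -/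
noncomputable def medianError {n T : ℕ} (x : Fin T → Sample n) (m : Sample n) : ℝ :=
  Metric.infDist (1 / 2 : ℝ) (Set.Icc (empCDF x ((m : ℕ) - 1)) (empCDF x (m : ℕ)))

/-- A deterministic online algorithm with time horizon `T`. After `s` rounds all it has learned
are the `s` feedback bits of those rounds (its own earlier queries are functions of these bits);
from them it computes the query of the next round and its current median estimate. -/
structure DetAlgorithm (n T : ℕ) where
  query : (s : Fin T) → (Fin s → Bool) → Query n
  estimate : (s : Fin (T + 1)) → (Fin s → Bool) → Sample n

namespace DetAlgorithm

variable {n T : ℕ}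

/-- The feedback bits `1(x_t ≤ q_t)` of the first `s` rounds, when the algorithm `D` is run on the
sample sequence `x`. -/
def feedback (D : DetAlgorithm n T) (x : Fin T → Sample n) :
    (s : ℕ) → s ≤ T → Fin s → Bool
  | 0, _ => Fin.elim0
  | s + 1, h =>
      Fin.snoc (α := fun _ => Bool) (D.feedback x s (Nat.le_of_succ_le h))
        (decide ((x ⟨s, h⟩ : ℕ) ≤ (D.query ⟨s, h⟩ (D.feedback x s (Nat.le_of_succ_le h)) : ℕ)))

/-- The estimate produced at the end of the last round `T`, on the sample sequence `x`. -/
def finalEstimate (D : DetAlgorithm n T) (x : Fin T → Sample n) : Sample n :=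
  D.estimate (Fin.last T) (D.feedback x T le_rfl)

end DetAlgorithm

/-- A randomized fixed-horizon online median estimation algorithm on `[n+1]`: given the horizon
`T`, it draws its internal randomness, i.e. it is a probability distribution over the deterministic
algorithms with horizon `T`. (There are finitely many of these, so that a `PMF` is the
most general distribution.) -/
abbrev FixedHorizonAlgorithm (n : ℕ) : Type := (T : ℕ) → PMF (DetAlgorithm n T)

/-- A fixed-horizon oblivious adversary: given the horizon `T`, it commits at the start to a
(possibly random) sequence of samples. -/
abbrev ObliviousAdversary (n : ℕ) : Type := (T : ℕ) → PMF (Fin T → Sample n)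

/-- The law of the random error `E(T, A, B)` of the algorithm `A` at time `T` against the oblivious
adversary `B`, whose random choices are independent of those of `A`. -/
noncomputable def errorLaw {n : ℕ} (A : FixedHorizonAlgorithm n) (B : ObliviousAdversary n)
    (T : ℕ) : PMF ℝ :=
  (A T).bind fun D => (B T).map fun x => medianError x (D.finalEstimate x)

/-- For all horizons `T > T₀` and all oblivious adversaries `B`, `E(T, A, B) ≤ ε` with probability
at least `3/4`. -/
def Succeeds {n : ℕ} (A : FixedHorizonAlgorithm n) (ε : ℝ) (T₀ : ℕ) : Prop :=
  ∀ T : ℕ, T₀ < T → ∀ B : ObliviousAdversary n,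
    (3 / 4 : ℝ≥0∞) ≤ (errorLaw A B T).toMeasure (Set.Iic ε)

/-- The fixed-horizon query complexity of `A` against oblivious adversaries at accuracy `ε`: the
least `T₀` such that `A` is `ε`-accurate in the above sense beyond `T₀`, or `∞` if there is none. -/
noncomputable def queryComplexity {n : ℕ} (A : FixedHorizonAlgorithm n) (ε : ℝ) : ℕ∞ :=
  ⨅ (T₀ : ℕ) (_ : Succeeds A ε T₀), (T₀ : ℕ∞)

end OnlineMedian

/-! The hard sequences have horizon `2N`, where `N` is a multiple of `n + 1`. The first `N` samples
are independent and nearly uniform: a mass `η = ±4ε` is moved between `j + 1` and `j`, which changes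
the CDF at `j` and nowhere else. The last `N` samples are deterministic, with just enough copies of
`1`, the rest being `n + 1`, to bring the mean of `F_T(j)` to `(1 + η) / 2 = 1/2 ± 2ε`. Once `N ε² ≥
1`, Chebyshev keeps `F_T(j)` within `ε` of its mean, so an accurate estimate must be at most `j` for
one sign of the tilt and above `j` for the other (`hardWeight_deviation`,
`prodExp_success_le_of_tilt_up`, `prodExp_success_le_of_tilt_down`).

The sign shows only in the first `N` rounds, and there only through queries at `j`, each of relative
entropy `O(ε²)`. Hence about `1/ε²` queries at `j` are needed (`Succeeds.le_sum_queryCost`). The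
entropy is taken from the uniform law to the tilted one, so the queries are counted under a law that
does not depend on `j`. The counts for different `j` therefore add up to at most `N`, and order `n`
values of `j` force `N` to be of order `n/ε²`. -/

namespace OnlineMedian

/-! ### Expectations under finite product laws -/

section ProductExpectation

variable {ι α : Type*} [Fintype ι] [DecidableEq ι] [Fintype α]

/-- The expectation of `f` under the product of the (real) weights `w t`. -/
noncomputable def prodExp (w : ι → α → ℝ) (f : (ι → α) → ℝ) : ℝ :=
  ∑ x, (∏ t, w t (x t)) * f x

/-- Each `w t` is a probability weight. -/
structure IsWeight (w : ι → α → ℝ) : Prop where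
  nonneg : ∀ t y, 0 ≤ w t y
  sum_eq : ∀ t, ∑ y, w t y = 1

theorem sum_prod_weight {w : ι → α → ℝ} (hw : IsWeight w) :
    ∑ x : ι → α, ∏ t, w t (x t) = 1 := by
  classical
  rw [← Fintype.prod_sum]
  simp [hw.sum_eq]

theorem prodExp_const {w : ι → α → ℝ} (hw : IsWeight w) (c : ℝ) :
    prodExp w (fun _ => c) = c := by
  simp [prodExp, ← Finset.sum_mul, sum_prod_weight hw]

theorem prodExp_mono {w : ι → α → ℝ} (hw : IsWeight w) {f g : (ι → α) → ℝ}
    (h : ∀ x, f x ≤ g x) : prodExp w f ≤ prodExp w g :=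
  Finset.sum_le_sum fun x _ =>
    mul_le_mul_of_nonneg_left (h x) (Finset.prod_nonneg fun t _ => hw.nonneg t _)

theorem prodExp_add (w : ι → α → ℝ) (f g : (ι → α) → ℝ) :
    prodExp w (fun x => f x + g x) = prodExp w f + prodExp w g := by
  simp [prodExp, mul_add, Finset.sum_add_distrib]

theorem prodExp_sub (w : ι → α → ℝ) (f g : (ι → α) → ℝ) :
    prodExp w (fun x => f x - g x) = prodExp w f - prodExp w g := by
  simp [prodExp, mul_sub, Finset.sum_sub_distrib]

theorem prodExp_const_mul (w : ι → α → ℝ) (c : ℝ) (f : (ι → α) → ℝ) :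
    prodExp w (fun x => c * f x) = c * prodExp w f := by
  simp only [prodExp, Finset.mul_sum]
  exact Finset.sum_congr rfl fun x _ => by ring

theorem prodExp_sum {κ : Type*} (s : Finset κ) (w : ι → α → ℝ) (f : κ → (ι → α) → ℝ) :
    prodExp w (fun x => ∑ i ∈ s, f i x) = ∑ i ∈ s, prodExp w (f i) := by
  simp only [prodExp, Finset.mul_sum]
  exact Finset.sum_comm

/-- Resampling one coordinate does not change a product expectation. -/
theorem prodExp_update {w : ι → α → ℝ} (hw : IsWeight w) (s : ι) (f : (ι → α) → ℝ) :
    prodExp w f = prodExp w (fun x => ∑ y, w s y * f (Function.update x s y)) := by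
  classical
  -- Exchanging coordinate `s` with an independent fresh copy preserves the joint weight of the
  -- pair.
  have hinv : Function.Involutive
      (fun p : (ι → α) × α => (Function.update p.1 s p.2, p.1 s)) := by
    intro p
    simp
  have hprod : ∀ (x : ι → α) (y : α),
      (∏ t, w t (Function.update x s y t)) * w s (x s) = (∏ t, w t (x t)) * w s y := by
    intro x y
    rw [← Finset.mul_prod_erase _ _ (Finset.mem_univ s),
      ← Finset.mul_prod_erase _ (fun t => w t (x t)) (Finset.mem_univ s)]
    have : ∏ t ∈ Finset.univ.erase s, w t (Function.update x s y t)
        = ∏ t ∈ Finset.univ.erase s, w t (x t) :=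
      Finset.prod_congr rfl fun t ht => by
        rw [Function.update_of_ne (Finset.ne_of_mem_erase ht)]
    rw [this, Function.update_self]
    ring
  have h1 : prodExp w f = ∑ p : (ι → α) × α, (∏ t, w t (p.1 t)) * w s p.2 * f p.1 := by
    rw [Fintype.sum_prod_type]
    refine Finset.sum_congr rfl fun x _ => ?_
    dsimp only
    rw [← Finset.sum_mul, ← Finset.mul_sum, hw.sum_eq, mul_one]
  have h2 : prodExp w (fun x => ∑ y, w s y * f (Function.update x s y))
      = ∑ p : (ι → α) × α, (∏ t, w t (p.1 t)) * w s p.2 * f (Function.update p.1 s p.2) := by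
    rw [Fintype.sum_prod_type]
    refine Finset.sum_congr rfl fun x _ => ?_
    rw [Finset.mul_sum]
    exact Finset.sum_congr rfl fun y _ => by ring
  rw [h1, h2]
  refine Fintype.sum_equiv hinv.toPerm _ _ fun p => ?_
  simp only [Function.Involutive.coe_toPerm, Function.update_idem, Function.update_eq_self]
  rw [hprod]

theorem prodExp_coord {w : ι → α → ℝ} (hw : IsWeight w) (s : ι) (f : α → ℝ) :
    prodExp w (fun x => f (x s)) = ∑ y, w s y * f y := by
  rw [prodExp_update hw s]
  simp only [Function.update_self]
  exact prodExp_const hw _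

/-- The variance of a sum of independent centred variables is the sum of the variances. -/
theorem prodExp_sq_sum {w : ι → α → ℝ} (hw : IsWeight w) (f : ι → α → ℝ)
    (hf : ∀ t, ∑ y, w t y * f t y = 0) :
    prodExp w (fun x => (∑ t, f t (x t)) ^ 2) = ∑ t, ∑ y, w t y * f t y ^ 2 := by
  have h : ∀ x : ι → α, (∑ t, f t (x t)) ^ 2 = ∑ t, ∑ t', f t (x t) * f t' (x t') := by
    intro x
    rw [sq, Finset.sum_mul_sum]
  simp only [h, prodExp_sum]
  refine Finset.sum_congr rfl fun t _ => ?_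
  rw [Finset.sum_eq_single t]
  · rw [← prodExp_coord hw t]
    simp only [sq]
  · intro t' _ hne
    rw [prodExp_update hw t]
    simp only [Function.update_self, Function.update_of_ne hne, ← mul_assoc, ← Finset.sum_mul,
      hf, zero_mul]
    exact prodExp_const hw 0
  · simp

theorem prodExp_chebyshev {w : ι → α → ℝ} (hw : IsWeight w) (f : ι → α → ℝ)
    (hf : ∀ t, ∑ y, w t y * f t y = 0) {r : ℝ} (hr : 0 < r) :
    prodExp w (fun x => if r ≤ |∑ t, f t (x t)| then (1 : ℝ) else 0)
      ≤ (∑ t, ∑ y, w t y * f t y ^ 2) / r ^ 2 := by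
  rw [← prodExp_sq_sum hw f hf, div_eq_inv_mul, ← prodExp_const_mul]
  refine prodExp_mono hw fun x => ?_
  split_ifs with h
  · rw [← div_eq_inv_mul, le_div_iff₀ (by positivity), one_mul]
    exact sq_le_sq' (by linarith [neg_abs_le r, abs_of_pos hr, abs_nonneg (∑ t, f t (x t))]) h
      |>.trans_eq (sq_abs _)
  · positivity

/-- The product probability distribution. -/
noncomputable def prodPMF (w : ι → α → ℝ) (hw : IsWeight w) : PMF (ι → α) :=
  PMF.ofFintype (fun x => ENNReal.ofReal (∏ t, w t (x t))) (by
    rw [← ENNReal.ofReal_sum_of_nonneg fun x _ => Finset.prod_nonneg fun t _ => hw.nonneg t _,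
      sum_prod_weight hw, ENNReal.ofReal_one])

theorem prodPMF_toReal (w : ι → α → ℝ) (hw : IsWeight w) (x : ι → α) :
    (prodPMF w hw x).toReal = ∏ t, w t (x t) := by
  rw [prodPMF, PMF.ofFintype_apply,
    ENNReal.toReal_ofReal (Finset.prod_nonneg fun t _ => hw.nonneg t _)]

end ProductExpectation

/-! ### Laws of feedback transcripts -/

variable {n T : ℕ}

/-- The cumulative distribution function of a weight on the samples. -/
noncomputable def weightCDF (v : Sample n → ℝ) (i : ℕ) : ℝ :=
  ∑ y, v y * if (y : ℕ) ≤ i then 1 else 0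

namespace DetAlgorithm

theorem feedback_congr (D : DetAlgorithm n T) {x x' : Fin T → Sample n} :
    ∀ (s : ℕ) (h : s ≤ T), (∀ t : Fin T, (t : ℕ) < s → x t = x' t) →
      D.feedback x s h = D.feedback x' s h
  | 0, _, _ => rfl
  | s + 1, h, hx => by
    have ih := D.feedback_congr s (Nat.le_of_succ_le h) fun t ht => hx t (by omega)
    simp only [feedback, ih, hx ⟨s, h⟩ (Nat.lt_succ_self s)]

/-- The conditional expectation of `g`, a function of the first `s + 1` feedback bits, given the
first `s` of them, if the sample of the next round has weight `v`. -/
noncomputable def condExp (D : DetAlgorithm n T) (v : Sample n → ℝ) (s : ℕ) (h : s + 1 ≤ T)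
    (g : (Fin (s + 1) → Bool) → ℝ) (b : Fin s → Bool) : ℝ :=
  weightCDF v (D.query ⟨s, h⟩ b) * g (Fin.snoc (α := fun _ => Bool) b true)
    + (1 - weightCDF v (D.query ⟨s, h⟩ b)) * g (Fin.snoc (α := fun _ => Bool) b false)

/-- The sample of round `s` is independent of the earlier feedback, which fixes the query; averaging
over that sample leaves a Bernoulli bit whose parameter is the CDF at the query. -/
theorem prodExp_feedback_succ (D : DetAlgorithm n T) {w : Fin T → Sample n → ℝ}
    (hw : IsWeight w) (s : ℕ) (h : s + 1 ≤ T) (g : (Fin (s + 1) → Bool) → ℝ) :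
    prodExp w (fun x => g (D.feedback x (s + 1) h))
      = prodExp w (fun x => D.condExp (w ⟨s, h⟩) s h g
          (D.feedback x s (Nat.le_of_succ_le h))) := by
  rw [prodExp_update hw ⟨s, h⟩]
  congr 1
  funext x
  have hfb : ∀ y, D.feedback (Function.update x ⟨s, h⟩ y) s (Nat.le_of_succ_le h)
      = D.feedback x s (Nat.le_of_succ_le h) := fun y =>
    D.feedback_congr s _ fun t ht => Function.update_of_ne (fun he => by simp [he] at ht) _ _
  set b := D.feedback x s (Nat.le_of_succ_le h) with hb
  set q : ℕ := (D.query ⟨s, h⟩ b : ℕ) with hq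
  have hg : ∀ y, g (D.feedback (Function.update x ⟨s, h⟩ y) (s + 1) h)
      = (if (y : ℕ) ≤ q then 1 else 0) * g (Fin.snoc (α := fun _ => Bool) b true)
        + (1 - if (y : ℕ) ≤ q then 1 else 0) * g (Fin.snoc (α := fun _ => Bool) b false) := by
    intro y
    simp only [feedback, hfb, Function.update_self, ← hq]
    by_cases hy : (y : ℕ) ≤ q <;> simp [hy]
  simp only [hg, condExp, ← hq]
  have h1 := hw.sum_eq ⟨s, h⟩
  simp only [weightCDF, mul_add, Finset.sum_add_distrib, ← mul_assoc, ← Finset.sum_mul, mul_sub,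
    mul_one, Finset.sum_sub_distrib, h1]

end DetAlgorithm

theorem weightCDF_mem_Icc {w : Fin T → Sample n → ℝ} (hw : IsWeight w) (t : Fin T) (i : ℕ) :
    weightCDF (w t) i ∈ Set.Icc (0 : ℝ) 1 := by
  constructor
  · exact Finset.sum_nonneg fun y _ => mul_nonneg (hw.nonneg t y) (by split_ifs <;> simp)
  · rw [← hw.sum_eq t]
    refine Finset.sum_le_sum fun y _ => mul_le_of_le_one_right (hw.nonneg t y) ?_
    split_ifs <;> simp

namespace DetAlgorithm

/-- A bounded function of the first `r` feedback bits has a conditional expectation given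
the first `s` of them; it depends on the laws of the rounds from `s` on only. -/
theorem exists_condExp (D : DetAlgorithm n T) {v : Fin T → Sample n → ℝ} (hv : IsWeight v)
    {s r : ℕ} (hsr : s ≤ r) (hr : r ≤ T) (g : (Fin r → Bool) → ℝ)
    (hg : ∀ b, g b ∈ Set.Icc (0 : ℝ) 1) :
    ∃ g' : (Fin s → Bool) → ℝ, (∀ b, g' b ∈ Set.Icc (0 : ℝ) 1) ∧
      ∀ w : Fin T → Sample n → ℝ, IsWeight w → (∀ t : Fin T, s ≤ (t : ℕ) → w t = v t) →
        prodExp w (fun x => g (D.feedback x r hr))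
          = prodExp w (fun x => g' (D.feedback x s (hsr.trans hr))) := by
  induction r, hsr using Nat.le_induction with
  | base => exact ⟨g, hg, fun _ _ _ => rfl⟩
  | succ r hsr ih =>
    obtain ⟨g', hg', h⟩ := ih (Nat.le_of_succ_le hr) (D.condExp (v ⟨r, hr⟩) r hr g) (by
      intro b
      have hp := weightCDF_mem_Icc hv ⟨r, hr⟩ (D.query ⟨r, hr⟩ b)
      have h1 := hg (Fin.snoc (α := fun _ => Bool) b true)
      have h2 := hg (Fin.snoc (α := fun _ => Bool) b false)
      have hp' : 0 ≤ 1 - weightCDF (v ⟨r, hr⟩) (D.query ⟨r, hr⟩ b) := sub_nonneg.2 hp.2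
      constructor
      · exact add_nonneg (mul_nonneg hp.1 h1.1) (mul_nonneg hp' h2.1)
      · have := add_le_add (mul_le_mul_of_nonneg_left h1.2 hp.1)
          (mul_le_mul_of_nonneg_left h2.2 hp')
        unfold condExp
        linarith)
    refine ⟨g', hg', fun w hw hwv => ?_⟩
    rw [D.prodExp_feedback_succ hw r hr g, hwv ⟨r, hr⟩ hsr]
    exact h w hw hwv

end DetAlgorithm

/-! ### Relative entropy of transcripts -/

/-- Jensen for `log` gives the Gibbs inequality with the relative entropy of the two Bernoulli laws
as error; `log u ≤ u - 1` then bounds that entropy by the chi-squared divergence. -/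
theorem bernoulli_gibbs {p q : ℝ} (hp : 0 < p) (hp1 : p < 1) (hq : 0 < q) (hq1 : q < 1)
    (a b : ℝ) :
    p * a + (1 - p) * b ≤ Real.log (q * Real.exp a + (1 - q) * Real.exp b)
      + (p - q) ^ 2 / (q * (1 - q)) := by
  have hp' : 0 < 1 - p := by linarith
  have hq' : 0 < 1 - q := by linarith
  have hj := strictConcaveOn_log_Ioi.concaveOn.2
    (x := q * Real.exp a / p) (y := (1 - q) * Real.exp b / (1 - p))
    (Set.mem_Ioi.2 (by positivity)) (Set.mem_Ioi.2 (by positivity)) hp.le hp'.le (by ring)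
  simp only [smul_eq_mul] at hj
  rw [mul_div_cancel₀ _ hp.ne', mul_div_cancel₀ _ hp'.ne'] at hj
  have e1 : Real.log (q * Real.exp a / p) = a - Real.log (p / q) := by
    rw [Real.log_div (by positivity) hp.ne', Real.log_mul hq.ne' (Real.exp_pos a).ne',
      Real.log_exp, Real.log_div hp.ne' hq.ne']
    ring
  have e2 : Real.log ((1 - q) * Real.exp b / (1 - p)) = b - Real.log ((1 - p) / (1 - q)) := by
    rw [Real.log_div (by positivity) hp'.ne', Real.log_mul hq'.ne' (Real.exp_pos b).ne',
      Real.log_exp, Real.log_div hp'.ne' hq'.ne']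
    ring
  rw [e1, e2] at hj
  have l1 := mul_le_mul_of_nonneg_left (Real.log_le_sub_one_of_pos (div_pos hp hq)) hp.le
  have l2 := mul_le_mul_of_nonneg_left (Real.log_le_sub_one_of_pos (div_pos hp' hq')) hp'.le
  have e3 : p * (p / q - 1) + (1 - p) * ((1 - p) / (1 - q) - 1)
      = (p - q) ^ 2 / (q * (1 - q)) := by
    field_simp
    ring
  linarith

namespace DetAlgorithm

/-- The expected total cost of the queries of the first `s` rounds. -/
noncomputable def queryCost (D : DetAlgorithm n T) (w : Fin T → Sample n → ℝ) (K : ℕ → ℝ)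
    (s : ℕ) (h : s ≤ T) : ℝ :=
  ∑ t : Fin s, prodExp w (fun x => K (D.query ⟨t, t.2.trans_le h⟩
    (D.feedback x t (t.2.le.trans h))))

theorem queryCost_succ (D : DetAlgorithm n T) (w : Fin T → Sample n → ℝ) (K : ℕ → ℝ)
    (s : ℕ) (h : s + 1 ≤ T) :
    D.queryCost w K (s + 1) h = D.queryCost w K s (Nat.le_of_succ_le h)
      + prodExp w (fun x => K (D.query ⟨s, h⟩ (D.feedback x s (Nat.le_of_succ_le h)))) := by
  simp [queryCost, Fin.sum_univ_castSucc]

/-- Gibbs' variational inequality for feedback transcripts: `K` bounds the relative entropy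
of one feedback bit. -/
theorem gibbs (D : DetAlgorithm n T) {w₀ w₁ : Fin T → Sample n → ℝ} (hw₀ : IsWeight w₀)
    (hw₁ : IsWeight w₁) (K : ℕ → ℝ) (s : ℕ) (h : s ≤ T)
    (hK : ∀ t : Fin T, (t : ℕ) < s → ∀ q : Query n, ∀ a b : ℝ,
      weightCDF (w₀ t) q * a + (1 - weightCDF (w₀ t) q) * b
        ≤ Real.log (weightCDF (w₁ t) q * Real.exp a + (1 - weightCDF (w₁ t) q) * Real.exp b)
          + K q)
    (g : (Fin s → Bool) → ℝ) :
    prodExp w₀ (fun x => g (D.feedback x s h))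
      ≤ Real.log (prodExp w₁ (fun x => Real.exp (g (D.feedback x s h))))
        + D.queryCost w₀ K s h := by
  induction s with
  | zero =>
    have e : ∀ x, D.feedback x 0 h = Fin.elim0 := fun _ => rfl
    simp [e, prodExp_const hw₀, prodExp_const hw₁, queryCost]
  | succ s ih =>
    rw [D.prodExp_feedback_succ hw₀ s h g,
      D.prodExp_feedback_succ hw₁ s h (fun b => Real.exp (g b)), queryCost_succ]
    set G : (Fin s → Bool) → ℝ := D.condExp (w₁ ⟨s, h⟩) s h fun b => Real.exp (g b) with hG
    have hpos : ∀ b, 0 < G b := by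
      intro b
      have hp := weightCDF_mem_Icc hw₁ ⟨s, h⟩ (D.query ⟨s, h⟩ b)
      have h1 := Real.exp_pos (g (Fin.snoc (α := fun _ => Bool) b true))
      have h2 := Real.exp_pos (g (Fin.snoc (α := fun _ => Bool) b false))
      rw [hG]
      unfold condExp
      rcases hp.1.eq_or_lt with h0 | h0
      · rw [← h0]
        simpa using h2
      · exact add_pos_of_pos_of_nonneg (mul_pos h0 h1)
          (mul_nonneg (sub_nonneg.2 hp.2) h2.le)
    -- Chain rule: the last round is absorbed into `log G`, whose exponential is the conditional
    -- expectation of `exp g` under `w₁`.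
    have hi := ih (Nat.le_of_succ_le h) (fun t ht => hK t (by omega)) (fun b => Real.log (G b))
    simp only [Real.exp_log (hpos _)] at hi
    have hstep := prodExp_mono hw₀ (fun x => hK ⟨s, h⟩ (Nat.lt_succ_self s)
      (D.query ⟨s, h⟩ (D.feedback x s (Nat.le_of_succ_le h)))
      (g (Fin.snoc (α := fun _ => Bool) (D.feedback x s (Nat.le_of_succ_le h)) true))
      (g (Fin.snoc (α := fun _ => Bool) (D.feedback x s (Nat.le_of_succ_le h)) false)))
    have : prodExp w₀ (fun x => D.condExp (w₀ ⟨s, h⟩) s h g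
        (D.feedback x s (Nat.le_of_succ_le h)))
      ≤ prodExp w₀ (fun x => Real.log (G (D.feedback x s (Nat.le_of_succ_le h))))
        + prodExp w₀ (fun x => K (D.query ⟨s, h⟩ (D.feedback x s (Nat.le_of_succ_le h)))) :=
      hstep.trans_eq (prodExp_add w₀ _ _)
    linarith

/-- Transcripts whose laws have small relative entropy are hard to tell apart. -/
theorem abs_prodExp_sub_le (D : DetAlgorithm n T) {w₀ w₁ : Fin T → Sample n → ℝ}
    (hw₀ : IsWeight w₀) (hw₁ : IsWeight w₁) (K : ℕ → ℝ) (s : ℕ) (h : s ≤ T)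
    (hK : ∀ t : Fin T, (t : ℕ) < s → ∀ q : Query n, ∀ a b : ℝ,
      weightCDF (w₀ t) q * a + (1 - weightCDF (w₀ t) q) * b
        ≤ Real.log (weightCDF (w₁ t) q * Real.exp a + (1 - weightCDF (w₁ t) q) * Real.exp b)
          + K q)
    (g : (Fin s → Bool) → ℝ) (hg : ∀ b, g b ∈ Set.Icc (0 : ℝ) 1)
    {l : ℝ} (hl : 0 < l) (hl1 : l ≤ 1) :
    |prodExp w₀ (fun x => g (D.feedback x s h)) - prodExp w₁ (fun x => g (D.feedback x s h))|
      ≤ l + D.queryCost w₀ K s h / l := by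
  -- The Gibbs inequality is tested on `m * g` and linearised by `log z ≤ z - 1` and `exp u ≤ 1 + u
  -- + u²` for `|u| ≤ 1`; the choices `m = ±l` bound the difference on both sides.
  have key : ∀ m : ℝ, |m| ≤ l →
      m * (prodExp w₀ (fun x => g (D.feedback x s h))
        - prodExp w₁ (fun x => g (D.feedback x s h))) ≤ l ^ 2 + D.queryCost w₀ K s h := by
    intro m hm
    have h1 := D.gibbs hw₀ hw₁ K s h hK (fun b => m * g b)
    have hmono : prodExp w₁ (fun x => Real.exp (m * g (D.feedback x s h)))
        ≤ prodExp w₁ (fun x => 1 + m * g (D.feedback x s h) + l ^ 2) := by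
      refine prodExp_mono hw₁ fun x => ?_
      have hb := hg (D.feedback x s h)
      have habs : |m * g (D.feedback x s h)| ≤ l := by
        rw [abs_mul, abs_of_nonneg hb.1]
        exact (mul_le_of_le_one_right (abs_nonneg m) hb.2).trans hm
      have h2 := (abs_le.1 (Real.abs_exp_sub_one_sub_id_le (habs.trans hl1))).2
      have h3 := sq_le_sq' (abs_le.1 habs).1 (abs_le.1 habs).2
      linarith
    have hpos : 0 < prodExp w₁ (fun x => Real.exp (m * g (D.feedback x s h))) := by
      have : prodExp w₁ (fun _ => Real.exp (-l))
          ≤ prodExp w₁ (fun x => Real.exp (m * g (D.feedback x s h))) := by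
        refine prodExp_mono hw₁ fun x => Real.exp_le_exp.2 ?_
        have hb := hg (D.feedback x s h)
        have habs : |m * g (D.feedback x s h)| ≤ l := by
          rw [abs_mul, abs_of_nonneg hb.1]
          exact (mul_le_of_le_one_right (abs_nonneg m) hb.2).trans hm
        exact (abs_le.1 habs).1
      rw [prodExp_const hw₁] at this
      exact (Real.exp_pos _).trans_le this
    have hlog := Real.log_le_sub_one_of_pos hpos
    rw [prodExp_add, prodExp_add, prodExp_const hw₁, prodExp_const hw₁,
      prodExp_const_mul] at hmono
    rw [prodExp_const_mul] at h1
    linarith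
  have e : l + D.queryCost w₀ K s h / l = (l ^ 2 + D.queryCost w₀ K s h) / l := by
    field_simp
  rw [e, abs_le]
  have k1 := key l (abs_of_pos hl).le
  have k2 := key (-l) (by rw [abs_neg, abs_of_pos hl])
  constructor
  · rw [neg_le, le_div_iff₀ hl]
    linarith
  · rw [le_div_iff₀ hl]
    linarith

/-- The expected numbers of queries at the different points add up to at most the number
of rounds. -/
theorem sum_queryCost_le (D : DetAlgorithm n T) {w : Fin T → Sample n → ℝ} (hw : IsWeight w)
    (J : Finset ℕ) (s : ℕ) (h : s ≤ T) :
    ∑ j ∈ J, D.queryCost w (fun q => if q = j then 1 else 0) s h ≤ s := by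
  simp only [queryCost]
  rw [Finset.sum_comm]
  have : (s : ℝ) = ∑ _t : Fin s, (1 : ℝ) := by simp
  rw [this]
  refine Finset.sum_le_sum fun t _ => ?_
  rw [← prodExp_sum]
  refine (prodExp_mono hw (g := fun _ => 1) fun x => ?_).trans_eq (prodExp_const hw 1)
  rw [Finset.sum_ite_eq]
  split_ifs <;> simp

theorem queryCost_const_mul (D : DetAlgorithm n T) (w : Fin T → Sample n → ℝ) (c : ℝ)
    (K : ℕ → ℝ) (s : ℕ) (h : s ≤ T) :
    D.queryCost w (fun q => c * K q) s h = c * D.queryCost w K s h := by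
  simp only [queryCost, prodExp_const_mul, Finset.mul_sum]

end DetAlgorithm

/-! ### Errors, empirical CDFs and averaging over the algorithm's randomness -/

instance : Finite (DetAlgorithm n T) :=
  Finite.of_injective
    (fun D : DetAlgorithm n T => (D.query, D.estimate)) fun D D' h => by
      cases D
      cases D'
      simpa using h

theorem empCDF_mono (x : Fin T → Sample n) : Monotone (empCDF x) := by
  intro i i' h
  unfold empCDF
  gcongr with t
  split_ifs <;> first | omega | norm_num

/-- By monotonicity the value at `j` is at most the left end of the interval, which exceeds `1/2` by
at most the error. -/
theorem empCDF_le_of_lt {x : Fin T → Sample n} {m : Sample n} {j : ℕ} {ε : ℝ}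
    (h : medianError x m ≤ ε) (hj : j < (m : ℕ)) : empCDF x j ≤ 1 / 2 + ε := by
  have hne : (Set.Icc (empCDF x ((m : ℕ) - 1)) (empCDF x (m : ℕ))).Nonempty :=
    Set.nonempty_Icc.2 (empCDF_mono x (Nat.sub_le _ _))
  have h1 : empCDF x ((m : ℕ) - 1) - 1 / 2 ≤ medianError x m :=
    (Metric.le_infDist hne).2 fun y hy => by
      rw [dist_comm, Real.dist_eq]
      exact (sub_le_sub_right hy.1 _).trans (le_abs_self _)
  have h2 := empCDF_mono x (show j ≤ (m : ℕ) - 1 by omega)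
  linarith

theorem le_empCDF_of_le {x : Fin T → Sample n} {m : Sample n} {j : ℕ} {ε : ℝ}
    (h : medianError x m ≤ ε) (hj : (m : ℕ) ≤ j) : 1 / 2 - ε ≤ empCDF x j := by
  have hne : (Set.Icc (empCDF x ((m : ℕ) - 1)) (empCDF x (m : ℕ))).Nonempty :=
    Set.nonempty_Icc.2 (empCDF_mono x (Nat.sub_le _ _))
  have h1 : 1 / 2 - empCDF x (m : ℕ) ≤ medianError x m :=
    (Metric.le_infDist hne).2 fun y hy => by
      rw [Real.dist_eq]
      exact (sub_le_sub_left hy.2 _).trans (le_abs_self _)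
  have h2 := empCDF_mono x hj
  linarith

theorem sum_toReal_eq_one {β : Type*} [Fintype β] (p : PMF β) : ∑ b, (p b).toReal = 1 := by
  rw [← ENNReal.toReal_sum fun b _ => p.apply_ne_top b, ← tsum_fintype (L := .unconditional _),
    p.tsum_coe, ENNReal.toReal_one]

theorem toReal_errorLaw [Fintype (DetAlgorithm n T)] (A : FixedHorizonAlgorithm n)
    (B : ObliviousAdversary n) {w : Fin T → Sample n → ℝ} (hw : IsWeight w)
    (hB : B T = prodPMF w hw) (ε : ℝ) :
    ((errorLaw A B T).toMeasure (Set.Iic ε)).toReal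
      = ∑ D, (A T D).toReal
          * prodExp w (fun x => if medianError x (D.finalEstimate x) ≤ ε then 1 else 0) := by
  rw [PMF.toMeasure_apply_eq_toOuterMeasure_apply _ measurableSet_Iic, errorLaw,
    PMF.toOuterMeasure_bind_apply, tsum_fintype, ENNReal.toReal_sum]
  · refine Finset.sum_congr rfl fun D _ => ?_
    rw [ENNReal.toReal_mul, PMF.toOuterMeasure_map_apply, PMF.toOuterMeasure_apply_fintype, hB,
      ENNReal.toReal_sum]
    · congr 1
      refine Finset.sum_congr rfl fun x _ => ?_
      by_cases hx : medianError x (D.finalEstimate x) ≤ ε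
      · rw [Set.indicator_of_mem (by exact hx), prodPMF_toReal]
        simp [hx]
      · rw [Set.indicator_of_notMem (by exact hx)]
        simp [hx]
    · intro x _
      exact ne_top_of_le_ne_top (PMF.apply_ne_top _ x) (Set.indicator_le_self _ _ _)
  · intro D _
    rw [← PMF.toMeasure_apply_eq_toOuterMeasure_apply _ measurableSet_Iic]
    exact ENNReal.mul_ne_top (PMF.apply_ne_top _ _) (MeasureTheory.measure_ne_top _ _)

theorem Succeeds.le_sum [Fintype (DetAlgorithm n T)] {A : FixedHorizonAlgorithm n} {ε : ℝ}
    {T₀ : ℕ} (h : Succeeds A ε T₀) (hT : T₀ < T) {w : Fin T → Sample n → ℝ} (hw : IsWeight w) :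
    3 / 4 ≤ ∑ D, (A T D).toReal
      * prodExp w (fun x => if medianError x (D.finalEstimate x) ≤ ε then 1 else 0) := by
  -- Only the law at horizon `T` matters; the constant sequence at other horizons is a filler.
  let B : ObliviousAdversary n :=
    Function.update (fun _ => PMF.pure fun _ => ⟨1, by simp⟩) T (prodPMF w hw)
  rw [← toReal_errorLaw A B hw (Function.update_self _ _ _) ε]
  have h1 := ENNReal.toReal_mono (MeasureTheory.measure_ne_top _ _) (h T hT B)
  simpa using h1

/-! ### The hard sample sequences -/

/-- The uniform weight on the samples, with mass `η` moved from `j + 1` to `j`. -/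
noncomputable def tiltedWeight (n j : ℕ) (η : ℝ) (y : Sample n) : ℝ :=
  1 / ((n : ℝ) + 1) + η * ((if (y : ℕ) = j then 1 else 0) - if (y : ℕ) = j + 1 then 1 else 0)

/-- The two mass changes cancel as soon as both are counted, so the tilt is invisible to every query
other than `j`. -/
theorem weightCDF_tiltedWeight {j : ℕ} (hj : 1 ≤ j) (hjn : j ≤ n) (η : ℝ) {i : ℕ}
    (hi : i ≤ n + 1) :
    weightCDF (tiltedWeight n j η) i = i / ((n : ℝ) + 1) + if i = j then η else 0 := by
  have h0 : weightCDF (tiltedWeight n j η) i = ∑ y ∈ Finset.Icc 1 (n + 1),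
      (1 / ((n : ℝ) + 1) + η * ((if y = j then 1 else 0) - if y = j + 1 then 1 else 0))
        * if y ≤ i then 1 else 0 :=
    Finset.sum_coe_sort (Finset.Icc 1 (n + 1)) (fun y : ℕ => (1 / ((n : ℝ) + 1)
      + η * ((if y = j then 1 else 0) - if y = j + 1 then 1 else 0)) * if y ≤ i then 1 else 0)
  have h1 : ∑ y ∈ Finset.Icc 1 (n + 1), (if y ≤ i then (1 : ℝ) else 0) = i := by
    rw [Finset.sum_boole]
    have : {y ∈ Finset.Icc 1 (n + 1) | y ≤ i} = Finset.Icc 1 i := by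
      ext y
      simp only [Finset.mem_filter, Finset.mem_Icc]
      omega
    rw [this, Nat.card_Icc, Nat.add_sub_cancel]
  have h2 : ∀ l, 1 ≤ l → l ≤ n + 1 → ∑ y ∈ Finset.Icc 1 (n + 1),
      (if y = l then (1 : ℝ) else 0) * (if y ≤ i then 1 else 0) = if l ≤ i then 1 else 0 := by
    intro l hl hl'
    simp only [ite_mul, one_mul, zero_mul]
    rw [Finset.sum_ite_eq', if_pos (Finset.mem_Icc.2 ⟨hl, hl'⟩)]
  simp only [h0, add_mul, mul_assoc, sub_mul, Finset.sum_add_distrib, ← Finset.mul_sum,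
    Finset.sum_sub_distrib, h1, h2 j hj (by omega), h2 (j + 1) (by omega) (by omega)]
  have h3 : η * ((if j ≤ i then (1 : ℝ) else 0) - if j + 1 ≤ i then 1 else 0)
      = if i = j then η else 0 := by
    split_ifs <;> first | omega | simp
  rw [h3]
  ring

theorem sum_tiltedWeight {j : ℕ} (hj : 1 ≤ j) (hjn : j ≤ n) (η : ℝ) :
    ∑ y, tiltedWeight n j η y = 1 := by
  have h := weightCDF_tiltedWeight hj hjn η (le_refl (n + 1))
  rw [if_neg (by omega), weightCDF] at h
  have h2 : ∀ y : Sample n, (y : ℕ) ≤ n + 1 := fun y => (Finset.mem_Icc.1 y.2).2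
  simp only [h2, if_true, mul_one] at h
  rw [h]
  push_cast
  field_simp
  simp

theorem tiltedWeight_nonneg {j : ℕ} {η : ℝ} (hη : |η| ≤ 1 / ((n : ℝ) + 1)) (y : Sample n) :
    0 ≤ tiltedWeight n j η y := by
  have := abs_le.1 hη
  unfold tiltedWeight
  split_ifs <;> first | omega | linarith

/-- `N` rounds with tilted uniform samples, then `k` samples `1`, then samples `n + 1`. -/
noncomputable def hardWeight (n N k j : ℕ) (η : ℝ) (T : ℕ) (t : Fin T) : Sample n → ℝ :=
  if (t : ℕ) < N then tiltedWeight n j η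
  else Pi.single (if (t : ℕ) < N + k then ⟨1, by simp⟩ else ⟨n + 1, by simp⟩) 1

theorem isWeight_hardWeight {N k j : ℕ} (hj : 1 ≤ j) (hjn : j ≤ n) {η : ℝ}
    (hη : |η| ≤ 1 / ((n : ℝ) + 1)) : IsWeight (hardWeight n N k j η T) where
  nonneg t y := by
    unfold hardWeight
    split_ifs
    · exact tiltedWeight_nonneg hη y
    all_goals exact (Pi.single_nonneg (α := fun _ : Sample n => ℝ)).2 zero_le_one y
  sum_eq t := by
    unfold hardWeight
    split_ifs
    · exact sum_tiltedWeight hj hjn η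
    all_goals simp

theorem weightCDF_single (y : Sample n) (i : ℕ) :
    weightCDF (Pi.single y 1) i = if (y : ℕ) ≤ i then 1 else 0 := by
  rw [weightCDF, Finset.sum_eq_single y]
  · rw [Pi.single_eq_same, one_mul]
  · intro y' _ hne
    rw [Pi.single_eq_of_ne hne, zero_mul]
  · simp

theorem weightCDF_hardWeight {N k j : ℕ} (hj : 1 ≤ j) (hjn : j ≤ n) (η : ℝ) (t : Fin T) :
    weightCDF (hardWeight n N k j η T t) j
      = if (t : ℕ) < N then j / ((n : ℝ) + 1) + η else if (t : ℕ) < N + k then 1 else 0 := by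
  unfold hardWeight
  split_ifs
  · rw [weightCDF_tiltedWeight hj hjn η (by omega), if_pos rfl]
  · rw [weightCDF_single, if_pos hj]
  · rw [weightCDF_single, if_neg (by simp; omega)]

theorem sum_weightCDF_hardWeight {N k j : ℕ} (hj : 1 ≤ j) (hjn : j ≤ n) (η : ℝ) (hk : k ≤ N) :
    ∑ t, weightCDF (hardWeight n N k j η (N + N) t) j = N * (j / ((n : ℝ) + 1) + η) + k := by
  simp only [weightCDF_hardWeight hj hjn]
  rw [Fin.sum_univ_eq_sum_range (fun t => if t < N then j / ((n : ℝ) + 1) + η else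
    if t < N + k then 1 else 0), Finset.sum_range_add]
  congr 1
  · rw [Finset.sum_congr rfl fun t ht => if_pos (Finset.mem_range.1 ht)]
    rw [Finset.sum_const, Finset.card_range, nsmul_eq_mul]
  · have : ∀ t ∈ Finset.range N, (if N + t < N then j / ((n : ℝ) + 1) + η else
        if N + t < N + k then 1 else 0) = if t < k then 1 else 0 := fun t _ => by
      simp
    rw [Finset.sum_congr rfl this, Finset.sum_boole]
    have : {t ∈ Finset.range N | t < k} = Finset.range k := by
      ext t
      simp only [Finset.mem_filter, Finset.mem_range]
      omega
    rw [this, Finset.card_range]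

theorem sum_weight_centred {w : Fin T → Sample n → ℝ} (hw : IsWeight w) (t : Fin T) (j : ℕ) :
    ∑ y, w t y * ((if (y : ℕ) ≤ j then 1 else 0) - weightCDF (w t) j) = 0 := by
  simp only [mul_sub, Finset.sum_sub_distrib, ← Finset.sum_mul, hw.sum_eq, one_mul]
  exact sub_self _

theorem sum_weight_centred_sq {w : Fin T → Sample n → ℝ} (hw : IsWeight w) (t : Fin T) (j : ℕ) :
    ∑ y, w t y * ((if (y : ℕ) ≤ j then 1 else 0) - weightCDF (w t) j) ^ 2
      = weightCDF (w t) j * (1 - weightCDF (w t) j) := by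
  set p := weightCDF (w t) j with hp
  have h : ∀ y : Sample n, w t y * ((if (y : ℕ) ≤ j then 1 else 0) - p) ^ 2
      = (1 - 2 * p) * (w t y * if (y : ℕ) ≤ j then 1 else 0) + p ^ 2 * w t y := by
    intro y
    split_ifs <;> ring
  simp only [h, Finset.sum_add_distrib, ← Finset.mul_sum, hw.sum_eq]
  rw [← weightCDF, ← hp]
  ring

/-- The empirical CDF at `j` is concentrated about `(1 + η) / 2`. -/
theorem hardWeight_deviation {N k j : ℕ} (hj : 1 ≤ j) (hjn : j ≤ n) {η : ℝ}
    (hη : |η| ≤ 1 / ((n : ℝ) + 1)) (hk : k ≤ N) (hkj : (N : ℝ) * (j / ((n : ℝ) + 1)) + k = N)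
    {ε : ℝ} (hε : 0 < ε) (hN : 1 ≤ N * ε ^ 2) :
    prodExp (hardWeight n N k j η (N + N))
      (fun x => if ε ≤ |empCDF x j - (1 + η) / 2| then 1 else 0) ≤ 1 / 16 := by
  have hN0 : (0 : ℝ) < N := by
    by_contra h
    have : (N : ℝ) * ε ^ 2 ≤ 0 := mul_nonpos_of_nonpos_of_nonneg (not_lt.1 h) (by positivity)
    linarith
  set w := hardWeight n N k j η (N + N) with hwdef
  have hw : IsWeight w := isWeight_hardWeight hj hjn hη
  have h1 := prodExp_chebyshev hw
    (fun t y => (if (y : ℕ) ≤ j then 1 else 0) - weightCDF (w t) j)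
    (fun t => sum_weight_centred hw t j) (r := 2 * N * ε) (by positivity)
  simp only [sum_weight_centred_sq hw] at h1
  -- The deterministic rounds have no variance, and a Bernoulli variance is at most `1/4`.
  have h2 : ∑ t, weightCDF (w t) j * (1 - weightCDF (w t) j) ≤ N / 4 := by
    have : ∀ t : Fin (N + N), weightCDF (w t) j * (1 - weightCDF (w t) j)
        ≤ if (t : ℕ) < N then 1 / 4 else 0 := by
      intro t
      rw [hwdef, weightCDF_hardWeight hj hjn]
      split_ifs
      · nlinarith [sq_nonneg (2 * (j / ((n : ℝ) + 1) + η) - 1)]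
      all_goals simp
    refine (Finset.sum_le_sum fun t _ => this t).trans_eq ?_
    rw [Fin.sum_univ_eq_sum_range (fun t => if t < N then (1 / 4 : ℝ) else 0),
      Finset.sum_range_add, Finset.sum_congr rfl fun t ht => if_pos (Finset.mem_range.1 ht)]
    simp
    ring
  have h3 : ∀ x : Fin (N + N) → Sample n,
      ∑ t, ((if (x t : ℕ) ≤ j then 1 else 0) - weightCDF (w t) j)
        = 2 * N * (empCDF x j - (1 + η) / 2) := by
    intro x
    rw [Finset.sum_sub_distrib, hwdef, sum_weightCDF_hardWeight hj hjn η hk, empCDF]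
    push_cast
    have : 2 * (N : ℝ) * ((∑ t, if (x t : ℕ) ≤ j then (1 : ℝ) else 0) / (N + N) - (1 + η) / 2)
        = (∑ t, if (x t : ℕ) ≤ j then (1 : ℝ) else 0) - (N + N * η) := by
      field_simp
      ring
    rw [this]
    linarith
  have h4 : ∀ x : Fin (N + N) → Sample n,
      (2 * N * ε ≤ |2 * N * (empCDF x j - (1 + η) / 2)|) ↔ ε ≤ |empCDF x j - (1 + η) / 2| := by
    intro x
    rw [abs_mul, abs_of_pos (show (0 : ℝ) < 2 * N by positivity)]
    exact mul_le_mul_iff_right₀ (by positivity)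
  simp only [h3, h4] at h1
  refine h1.trans ?_
  -- Chebyshev gives `(N / 4) / (2 N ε)² = 1 / (16 N ε²)`, and `N ε² ≥ 1`.
  rw [div_le_div_iff₀ (by positivity) (by norm_num)]
  nlinarith [mul_le_mul_of_nonneg_left hN hN0.le]

/-! ### Testing the sign of the tilt -/

/-- Against a sample sequence tilted upwards, an accurate estimate is mostly at most `j`. -/
theorem prodExp_success_le_of_tilt_up (D : DetAlgorithm n T) {w : Fin T → Sample n → ℝ}
    (hw : IsWeight w) {j : ℕ} {ε : ℝ}
    (hdev : prodExp w (fun x => if ε ≤ |empCDF x j - (1 + 4 * ε) / 2| then 1 else 0) ≤ 1 / 16) :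
    prodExp w (fun x => if medianError x (D.finalEstimate x) ≤ ε then 1 else 0)
      ≤ prodExp w (fun x => if (D.finalEstimate x : ℕ) ≤ j then 1 else 0) + 1 / 16 := by
  refine le_trans ?_ (add_le_add_right hdev _)
  rw [← prodExp_add]
  refine prodExp_mono hw fun x => ?_
  split_ifs with h1 h2 h3 h3 <;> try norm_num
  refine h3 ?_
  -- An accurate estimate above `j` forces `F_T(j) ≤ 1/2 + ε`, which is `ε` below the centre `1/2 +
  -- 2ε`: this margin is the reason for the tilt `4ε`.
  have := empCDF_le_of_lt h1 (not_le.1 h2)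
  rw [abs_sub_comm]
  exact le_trans (by linarith) (le_abs_self _)

/-- Against a sample sequence tilted downwards, an accurate estimate is mostly above `j`. -/
theorem prodExp_success_le_of_tilt_down (D : DetAlgorithm n T) {w : Fin T → Sample n → ℝ}
    (hw : IsWeight w) {j : ℕ} {ε : ℝ}
    (hdev : prodExp w (fun x => if ε ≤ |empCDF x j - (1 + -(4 * ε)) / 2| then 1 else 0)
      ≤ 1 / 16) :
    prodExp w (fun x => if medianError x (D.finalEstimate x) ≤ ε then 1 else 0)
      ≤ 1 - prodExp w (fun x => if (D.finalEstimate x : ℕ) ≤ j then 1 else 0) + 1 / 16 := by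
  refine le_trans ?_ (add_le_add_right hdev _)
  refine (prodExp_mono hw (g := fun x => 1 - (if (D.finalEstimate x : ℕ) ≤ j then 1 else 0)
    + if ε ≤ |empCDF x j - (1 + -(4 * ε)) / 2| then 1 else 0) fun x => ?_).trans_eq
    (by rw [prodExp_add, prodExp_sub, prodExp_const hw])
  split_ifs with h1 h2 h3 h3 <;> try norm_num
  refine h3 ?_
  have := le_empCDF_of_le h1 h2
  exact le_trans (by linarith) (le_abs_self _)

/-- The uniform weight in every round. -/
noncomputable def uniformWeight (n T : ℕ) (_ : Fin T) (_ : Sample n) : ℝ := 1 / ((n : ℝ) + 1)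

theorem uniformWeight_eq (j : ℕ) (t : Fin T) : uniformWeight n T t = tiltedWeight n j 0 := by
  funext y
  simp [uniformWeight, tiltedWeight]

theorem isWeight_uniformWeight : IsWeight (uniformWeight n T) where
  nonneg t y := by
    unfold uniformWeight
    positivity
  sum_eq t := by
    simp only [uniformWeight, Finset.sum_const, Finset.card_univ, Fintype.card_coe, Nat.card_Icc]
    simp
    field_simp

/-- The tilt is hard to detect without queries at `j`. -/
theorem gibbs_hardWeight {N k j : ℕ} (hj : 1 ≤ j) (hjn : j ≤ n) {η : ℝ}
    (hj4 : (1 : ℝ) / 4 ≤ j / ((n : ℝ) + 1)) (hj2 : j / ((n : ℝ) + 1) ≤ (1 : ℝ) / 2)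
    (hη : |η| ≤ 1 / 8) (t : Fin T) (ht : (t : ℕ) < N) (q : Query n) (a b : ℝ) :
    weightCDF (uniformWeight n T t) q * a + (1 - weightCDF (uniformWeight n T t) q) * b
      ≤ Real.log (weightCDF (hardWeight n N k j η T t) q * Real.exp a
          + (1 - weightCDF (hardWeight n N k j η T t) q) * Real.exp b)
        + 10 * η ^ 2 * (if (q : ℕ) = j then 1 else 0) := by
  have hq := Finset.mem_Icc.1 q.2
  have hq0 : (0 : ℝ) < (q : ℕ) / ((n : ℝ) + 1) := by
    have : (0 : ℝ) < (q : ℕ) := by exact_mod_cast hq.1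
    positivity
  have hq1 : ((q : ℕ) : ℝ) / ((n : ℝ) + 1) < 1 := by
    rw [div_lt_one (by positivity)]
    have : ((q : ℕ) : ℝ) ≤ n := by exact_mod_cast hq.2
    linarith
  rw [uniformWeight_eq j, hardWeight, if_pos ht, weightCDF_tiltedWeight hj hjn 0 (by omega),
    weightCDF_tiltedWeight hj hjn η (by omega)]
  simp only [ite_self, add_zero]
  by_cases h : (q : ℕ) = j
  · rw [if_pos h, if_pos h, mul_one]
    rw [← h] at hj4 hj2
    set p : ℝ := (q : ℕ) / ((n : ℝ) + 1)
    have he := abs_le.1 hη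
    refine (bernoulli_gibbs (q := p + η) hq0 hq1 (by linarith) (by linarith) a b).trans
      (add_le_add_right ?_ _)
    -- Since `p + η` lies in `[1/8, 7/8]`, the product is at least `7/64`; this is the source of the
    -- factor `10`.
    have h1 : (1 : ℝ) / 10 ≤ (p + η) * (1 - (p + η)) := by
      nlinarith [mul_nonneg (show (0 : ℝ) ≤ p + η - 1 / 8 by linarith)
        (show (0 : ℝ) ≤ 7 / 8 - (p + η) by linarith)]
    rw [div_le_iff₀ (by linarith)]
    nlinarith [mul_le_mul_of_nonneg_left h1 (sq_nonneg η)]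
  · rw [if_neg h, if_neg h, add_zero, mul_zero, add_zero]
    simpa using bernoulli_gibbs hq0 hq1 hq0 hq1 a b

/-- From round `N` on, both tilts have the same law, so one function of the first `N` bits
represents the event for both. Each tilt is then compared with the uniform law at `l = 1/16`, which
costs `1/16 + 16 * 10 * η²` times the query count; the two costs add up. -/
theorem abs_finalEstimate_le_sub_le (D : DetAlgorithm n T) {N k j : ℕ} (hNT : N ≤ T)
    (hj : 1 ≤ j) (hjn : j ≤ n) {η : ℝ} (hj4 : (1 : ℝ) / 4 ≤ j / ((n : ℝ) + 1))
    (hj2 : j / ((n : ℝ) + 1) ≤ (1 : ℝ) / 2) (hη : |η| ≤ 1 / 8)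
    (hη' : |η| ≤ 1 / ((n : ℝ) + 1)) :
    prodExp (hardWeight n N k j η T) (fun x => if (D.finalEstimate x : ℕ) ≤ j then 1 else 0)
      - prodExp (hardWeight n N k j (-η) T)
          (fun x => if (D.finalEstimate x : ℕ) ≤ j then 1 else 0)
      ≤ 1 / 8 + 320 * η ^ 2
          * D.queryCost (uniformWeight n T) (fun q => if q = j then 1 else 0) N hNT := by
  have hη1 : |-η| ≤ 1 / 8 := by rwa [abs_neg]
  have hη1' : |-η| ≤ 1 / ((n : ℝ) + 1) := by rwa [abs_neg]
  have hp : IsWeight (hardWeight n N k j η T) := isWeight_hardWeight hj hjn hη'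
  have hm : IsWeight (hardWeight n N k j (-η) T) := isWeight_hardWeight hj hjn hη1'
  obtain ⟨g, hg, hgw⟩ := D.exists_condExp hp hNT le_rfl
    (fun b => if (D.estimate (Fin.last T) b : ℕ) ≤ j then 1 else 0) (fun b => by
      split_ifs <;> simp)
  have e1 := hgw _ hp fun _ _ => rfl
  have e2 := hgw _ hm fun t ht => by
    simp [hardWeight, not_lt.2 ht]
  have i1 := D.abs_prodExp_sub_le isWeight_uniformWeight hp
    (fun q => 10 * η ^ 2 * if q = j then 1 else 0) N hNT
    (gibbs_hardWeight hj hjn hj4 hj2 hη) g hg (l := 1 / 16) (by norm_num) (by norm_num)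
  have i2 := D.abs_prodExp_sub_le isWeight_uniformWeight hm
    (fun q => 10 * (-η) ^ 2 * if q = j then 1 else 0) N hNT
    (gibbs_hardWeight hj hjn hj4 hj2 hη1) g hg (l := 1 / 16) (by norm_num) (by norm_num)
  rw [DetAlgorithm.queryCost_const_mul D (uniformWeight n T) _
    (fun q => if q = j then 1 else 0)] at i1 i2
  have i1' := (abs_le.1 i1).1
  have i2' := (abs_le.1 i2).2
  unfold DetAlgorithm.finalEstimate
  rw [e1, e2]
  rw [neg_sq] at i2'
  linarith

/-- An accurate algorithm queries every `j` in the middle of the range often. -/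
theorem Succeeds.le_sum_queryCost {N k j T₀ : ℕ} [Fintype (DetAlgorithm n (N + N))]
    {A : FixedHorizonAlgorithm n} {ε : ℝ} (h : Succeeds A ε T₀) (hT : T₀ < N + N)
    (hj : 1 ≤ j) (hjn : j ≤ n) (hj4 : (1 : ℝ) / 4 ≤ j / ((n : ℝ) + 1))
    (hj2 : j / ((n : ℝ) + 1) ≤ (1 : ℝ) / 2) (hε : 0 < ε) (hε8 : 4 * ε ≤ 1 / 8)
    (hεn : 4 * ε ≤ 1 / ((n : ℝ) + 1)) (hk : k ≤ N)
    (hkj : (N : ℝ) * (j / ((n : ℝ) + 1)) + k = N) (hN : 1 ≤ N * ε ^ 2) :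
    1 / 4 ≤ 5120 * ε ^ 2 * ∑ D, (A (N + N) D).toReal
      * D.queryCost (uniformWeight n (N + N)) (fun q => if q = j then 1 else 0) N
          (Nat.le_add_right N N) := by
  have habs : |4 * ε| = 4 * ε := abs_of_pos (by positivity)
  have h8 : |4 * ε| ≤ 1 / 8 := habs.trans_le hε8
  have hn : |4 * ε| ≤ 1 / ((n : ℝ) + 1) := habs.trans_le hεn
  have hn' : |-(4 * ε)| ≤ 1 / ((n : ℝ) + 1) := by rwa [abs_neg]
  have hp : IsWeight (hardWeight n N k j (4 * ε) (N + N)) := isWeight_hardWeight hj hjn hn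
  have hm : IsWeight (hardWeight n N k j (-(4 * ε)) (N + N)) := isWeight_hardWeight hj hjn hn'
  have s1 := h.le_sum hT hp
  have s2 := h.le_sum hT hm
  have hsum := sum_toReal_eq_one (A (N + N))
  -- Here `5/4` is `1`, plus `1/16` for each deviation event, plus `1/8` from the comparison. The
  -- two success probabilities average to at least `3/4` each, which leaves `1/4`.
  have key : ∀ D : DetAlgorithm n (N + N),
      prodExp (hardWeight n N k j (4 * ε) (N + N))
          (fun x => if medianError x (D.finalEstimate x) ≤ ε then 1 else 0)
        + prodExp (hardWeight n N k j (-(4 * ε)) (N + N))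
          (fun x => if medianError x (D.finalEstimate x) ≤ ε then 1 else 0)
      ≤ 5 / 4 + 5120 * ε ^ 2
        * D.queryCost (uniformWeight n (N + N)) (fun q => if q = j then 1 else 0) N
            (Nat.le_add_right N N) := by
    intro D
    have a1 := prodExp_success_le_of_tilt_up D hp
      (hardWeight_deviation hj hjn hn hk hkj hε hN)
    have a2 := prodExp_success_le_of_tilt_down D hm
      (hardWeight_deviation hj hjn hn' hk hkj hε hN)
    have a3 := abs_finalEstimate_le_sub_le D (k := k) (Nat.le_add_right N N) hj hjn hj4 hj2 h8 hn
    have e : 320 * (4 * ε) ^ 2 = 5120 * ε ^ 2 := by ring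
    rw [e] at a3
    linarith
  have hle := Finset.sum_le_sum fun D (_ : D ∈ Finset.univ) =>
    mul_le_mul_of_nonneg_left (key D) (ENNReal.toReal_nonneg (a := A (N + N) D))
  simp only [mul_add, Finset.sum_add_distrib, ← Finset.sum_mul, hsum, one_mul] at hle
  have e : ∀ D : DetAlgorithm n (N + N), (A (N + N) D).toReal * (5120 * ε ^ 2
      * D.queryCost (uniformWeight n (N + N)) (fun q => if q = j then 1 else 0) N
          (Nat.le_add_right N N)) = 5120 * ε ^ 2 * ((A (N + N) D).toReal
      * D.queryCost (uniformWeight n (N + N)) (fun q => if q = j then 1 else 0) N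
          (Nat.le_add_right N N)) := fun D => by ring
  simp only [e, ← Finset.mul_sum] at hle
  linarith

/-! ### Summation over the tilt positions and choice of the horizon -/

theorem Succeeds.le_of_lt {M T₀ : ℕ} {A : FixedHorizonAlgorithm n} {ε : ℝ}
    (h : Succeeds A ε T₀) (hn : 8 ≤ n) (hT : T₀ < (n + 1) * M + (n + 1) * M)
    (hε : 0 < ε) (hεn : ε ≤ 1 / 8 / n) (hN : 1 ≤ ((n : ℝ) + 1) * M * ε ^ 2) :
    (n : ℝ) ≤ 163840 * ε ^ 2 * (((n : ℝ) + 1) * M) := by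
  classical
  set N := (n + 1) * M with hNdef
  have hNr : (N : ℝ) = ((n : ℝ) + 1) * M := by
    rw [hNdef]
    push_cast
    ring
  rw [← hNr] at hN ⊢
  have := Fintype.ofFinite (DetAlgorithm n (N + N))
  have hn8 : (8 : ℝ) ≤ n := by exact_mod_cast hn
  have hεn' : ε * (8 * n) ≤ 1 := by
    rwa [div_div, le_div_iff₀ (by positivity)] at hεn
  -- Positions whose uniform CDF lies between `1/4` and `1/2`. There are at least `n / 8` of them,
  -- whence `163840 = 8 * 4 * 5120`.
  set J := Finset.Icc ((n + 1) / 4 + 1) ((n + 1) / 2) with hJ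
  have hj : ∀ j ∈ J, 1 / 4 ≤ 5120 * ε ^ 2 * ∑ D, (A (N + N) D).toReal
      * D.queryCost (uniformWeight n (N + N)) (fun q => if q = j then 1 else 0) N
          (Nat.le_add_right N N) := by
    intro j hj
    have hjm := Finset.mem_Icc.1 hj
    have hjn : j ≤ n := by omega
    have h4 : (n : ℝ) + 1 ≤ j * 4 := by exact_mod_cast (by omega : n + 1 ≤ j * 4)
    have h2 : (j : ℝ) * 2 ≤ n + 1 := by exact_mod_cast (by omega : j * 2 ≤ n + 1)
    -- As `N = (n + 1) * M`, the uniform rounds contribute `j * M` on average, and this `k`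
    -- completes it to exactly `N`.
    refine h.le_sum_queryCost (k := (n + 1 - j) * M) hT (by omega) hjn ?_ ?_ hε ?_ ?_ ?_ ?_ hN
    · rw [div_le_div_iff₀ (by norm_num) (by positivity)]
      linarith
    · rw [div_le_div_iff₀ (by positivity) (by norm_num)]
      linarith
    · nlinarith
    · rw [le_div_iff₀ (by positivity)]
      nlinarith
    · exact Nat.mul_le_mul_right M (Nat.sub_le _ _)
    · rw [hNr]
      push_cast [Nat.cast_sub (by omega : j ≤ n + 1)]
      field_simp
      ring
  have hsum := Finset.sum_le_sum hj
  rw [Finset.sum_const, ← Finset.mul_sum, Finset.sum_comm, nsmul_eq_mul] at hsum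
  simp only [← Finset.mul_sum] at hsum
  have hQ : ∑ D, (A (N + N) D).toReal * ∑ j ∈ J,
      D.queryCost (uniformWeight n (N + N)) (fun q => if q = j then 1 else 0) N
          (Nat.le_add_right N N) ≤ N := by
    calc _ ≤ ∑ D, (A (N + N) D).toReal * (N : ℝ) :=
          Finset.sum_le_sum fun D _ => mul_le_mul_of_nonneg_left
            (D.sum_queryCost_le isWeight_uniformWeight J N _) ENNReal.toReal_nonneg
      _ = N := by rw [← Finset.sum_mul, sum_toReal_eq_one, one_mul]
  have hcard : (n : ℝ) ≤ 8 * J.card := by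
    rw [hJ, Nat.card_Icc]
    exact_mod_cast (by omega : n ≤ 8 * ((n + 1) / 2 + 1 - ((n + 1) / 4 + 1)))
  have := mul_le_mul_of_nonneg_left hQ (show 0 ≤ 5120 * ε ^ 2 by positivity)
  linarith

/-- A lower bound for the horizon beyond which an algorithm is accurate. -/
theorem Succeeds.lower_bound {T₀ : ℕ} {A : FixedHorizonAlgorithm n} {ε : ℝ}
    (h : Succeeds A ε T₀) (hn : 2000000 ≤ n) (hε : 0 < ε) (hεn : ε ≤ 1 / 8 / n) :
    1 / 1000000 * (n / ε ^ 2) ≤ T₀ := by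
  by_contra hlt
  rw [not_le] at hlt
  have hn' : (2000000 : ℝ) ≤ n := by exact_mod_cast hn
  have hεn' : ε * (8 * n) ≤ 1 := by
    rwa [div_div, le_div_iff₀ (by positivity)] at hεn
  have hε1 : ε ≤ 1 / 16000000 := by nlinarith
  have hεsq : 2 * ε ^ 2 ≤ 1 / 1000000 := by nlinarith
  have hε2 : 0 < ε ^ 2 := by positivity
  -- This puts `M ε²` between `1/2000000` and `1/1000000`. The lower bound yields `T₀ < 2N` and, as
  -- `n ≥ 2000000`, `N ε² ≥ 1`; the upper one contradicts `n ≤ 163840 * ε² * N`.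
  set M := ⌊1 / 1000000 / ε ^ 2⌋₊ with hM
  have hM1 : M * ε ^ 2 ≤ 1 / 1000000 := by
    rw [← le_div_iff₀ hε2]
    exact Nat.floor_le (by positivity)
  have hM2 : 1 / 2000000 ≤ M * ε ^ 2 := by
    have := Nat.lt_floor_add_one (1 / 1000000 / ε ^ 2)
    rw [← hM, div_lt_iff₀ hε2] at this
    linarith
  have hT : T₀ < (n + 1) * M + (n + 1) * M := by
    have : (T₀ : ℝ) < ((n : ℝ) + 1) * M + ((n : ℝ) + 1) * M := by
      refine hlt.trans ?_
      rw [← mul_div_assoc, div_lt_iff₀ hε2]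
      nlinarith
    exact_mod_cast this
  have := h.le_of_lt (by omega) hT hε hεn (by nlinarith)
  nlinarith

theorem ofReal_le_queryComplexity {A : FixedHorizonAlgorithm n} {ε : ℝ} (hn : 2000000 ≤ n)
    (hε : 0 < ε) (hεn : ε ≤ 1 / 8 / n) :
    ENNReal.ofReal (1 / 1000000 * (n / ε ^ 2)) ≤ (queryComplexity A ε : ℝ≥0∞) := by
  have h : ((⌈1 / 1000000 * ((n : ℝ) / ε ^ 2)⌉₊ : ℕ) : ℕ∞) ≤ queryComplexity A ε :=
    le_iInf₂ fun T₀ hT₀ => Nat.cast_le.2 (Nat.ceil_le.2 (hT₀.lower_bound hn hε hεn))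
  calc _ ≤ ENNReal.ofReal (⌈1 / 1000000 * ((n : ℝ) / ε ^ 2)⌉₊ : ℕ) :=
        ENNReal.ofReal_le_ofReal (Nat.le_ceil _)
    _ = (((⌈1 / 1000000 * ((n : ℝ) / ε ^ 2)⌉₊ : ℕ) : ℕ∞) : ℝ≥0∞) := by
        rw [ENNReal.ofReal_natCast, ENat.toENNReal_coe]
    _ ≤ _ := ENat.toENNReal_le.2 h

end OnlineMedian

theorem mainTheorem4 :
    (∃ (n₀ : ℕ) (a c : ℝ), 0 < a ∧ 0 < c ∧
      ∀ n : ℕ, n₀ ≤ n → ∀ ε : ℝ, 0 < ε → ε ≤ a / n →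
        ∀ A : OnlineMedian.FixedHorizonAlgorithm n,
          ENNReal.ofReal (c * (n / ε ^ 2)) ≤ (OnlineMedian.queryComplexity A ε : ℝ≥0∞)) ∧
    (∀ A : (n : ℕ+) → OnlineMedian.FixedHorizonAlgorithm n,
      ¬ Tendsto
        (fun p : ℕ+ × ℝ =>
          (OnlineMedian.queryComplexity (A p.1) p.2 : ℝ≥0∞) /
            ENNReal.ofReal ((p.1 : ℝ) / p.2 ^ 2))
        (atTop ×ˢ 𝓝[>] (0 : ℝ)) (𝓝 0)) := by
  refine ⟨⟨2000000, 1 / 8, 1 / 1000000, by norm_num, by norm_num, fun n hn ε hε hεn A =>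
    OnlineMedian.ofReal_le_queryComplexity hn hε hεn⟩, fun A hA => ?_⟩
  have hev := hA.eventually (gt_mem_nhds
    (show (0 : ℝ≥0∞) < ENNReal.ofReal (1 / 1000000) by simp))
  -- Currying the product filter fixes a large `n` before `ε` tends to `0`, so that `ε ≤ 1 / (8 n)`
  -- can be reached.
  obtain ⟨n, hmem, hn⟩ := (hev.curry.and (eventually_ge_atTop (2000000 : ℕ+))).exists
  have hn' : 2000000 ≤ (n : ℕ) := by exact_mod_cast hn
  have hn0 : (0 : ℝ) < (n : ℕ) := by exact_mod_cast n.pos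
  obtain ⟨ε, ⟨hlt, hε⟩⟩ := (hmem.and
    (Ioc_mem_nhdsGT (show (0 : ℝ) < 1 / 8 / (n : ℕ) by positivity))).exists
  have hX : 0 < ((n : ℕ) : ℝ) / ε ^ 2 := div_pos hn0 (pow_pos hε.1 2)
  have hle := OnlineMedian.ofReal_le_queryComplexity (A := A n) hn' hε.1 hε.2
  rw [ENNReal.ofReal_mul (by norm_num)] at hle
  exact absurd hlt (not_lt.2 ((ENNReal.le_div_iff_mul_le
    (Or.inl (ENNReal.ofReal_pos.2 hX).ne') (Or.inl ENNReal.ofReal_ne_top)).2 hle))
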